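/- Let $m\ge 1$, let $\{G(k)\}_{k\ge 0}$ be a deterministic sequence of simple undirected graphs on $[m]=\{1,\dots,m\}$, let $\gamma\in(0,1)$ and let $\gamma(k)\in(0,\gamma]$ for all $k\ge 0$. At each time $k\ge0$ an agent $a(k)\in[m]$ wakes up, where the $a(k)$ are independent and uniformly distributed on $[m]$. The time-varying broadcast gossip model is the random chain $\{W(k)\}_{k\ge0}$ of $m\times m$ matrices $$W(k)=I-\gamma(k)\sum_{j\in N_i(k)}e_j(e_j-e_i)^T\quad\text{if } a(k)=i,$$ where $N_i(k)$ is the set of neighbours of $i$ in $G(k)$ and $e_1,\dots,e_m$ is the standard basis of $\mathbb{R}^m$. (So at time $k$ each neighbour $j$ of the broadcasting agent $i$ updates $x_j(k+1)=\gamma(k)x_i(k)+(1-\gamma(k))x_j(k)$, and the other agents keep their values.) For a sequence of matrices $\{A(k)\}$ consider the dynamics $x(k+1)=A(k)x(k)$, $k\ge t_0$. The sequence is *stable* if $\lim_{k\to\infty}x_i(k)$ exists for every $i$, every $t_0\ge0$ and every $x(t_0)\in\mathbb{R}^m$; indices $i,j$ are *mutually weakly ergodic*, written $i\leftrightarrow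 j$, if $\lim_{k\to\infty}(x_i(k)-x_j(k))=0$ for every $t_0\ge0$ and every $x(t_0)\in\mathbb{R}^m$; the sequence is *ergodic* if this holds for all $i,j$. A random chain has one of these properties if almost every realization has it, and its *ergodicity classes* are the equivalence classes of the relation "$i\leftrightarrow j$ almost surely". The *infinite flow graph* of $\{W(k)\}$ is the simple graph $G_b^\infty$ on $[m]$ in which distinct $i,j$ are adjacent if and only if $\sum_{k=0}^\infty (W_{ij}(k)+W_{ji}(k))=\infty$ almost surely. Then: 1. The broadcast gossip model is stable almost surely. 2. Two agents $i,j$ are in the same ergodicity class if and only if they lie in the same connected component of $G_b^\infty$; if they lie in different components, then $\mathbb{P}(i\leftrightarrow j)=0$. 3. The model is ergodic if and only if $G_b^\infty$ is connected. -/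

import Mathlib

open MeasureTheory ProbabilityTheory Filter Topology
open scoped Matrix ENNReal

namespace RandomChain

/-- `x` solves the linear dynamics `x(k+1) = A(k) x(k)` for all `k ≥ t₀`; the values `x k` with
`k < t₀` are irrelevant. -/
def IsTrajectory {m : ℕ} (A : ℕ → Matrix (Fin m) (Fin m) ℝ) (t₀ : ℕ) (x : ℕ → Fin m → ℝ) : Prop :=
  ∀ k, t₀ ≤ k → x (k + 1) = A k *ᵥ x k

/-- The indices `i` and `j` are mutually weakly ergodic for the deterministic chain `A`. -/
def MutuallyWeaklyErgodic {m : ℕ} (A : ℕ → Matrix (Fin m) (Fin m) ℝ) (i j : Fin m) : Prop :=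
  ∀ (t₀ : ℕ) (x : ℕ → Fin m → ℝ), IsTrajectory A t₀ x →
    Tendsto (fun k => x k i - x k j) atTop (𝓝 0)

/-- The deterministic chain `A` is ergodic. -/
def Ergodic {m : ℕ} (A : ℕ → Matrix (Fin m) (Fin m) ℝ) : Prop :=
  ∀ (t₀ : ℕ) (x : ℕ → Fin m → ℝ), IsTrajectory A t₀ x →
    ∀ i j, Tendsto (fun k => x k i - x k j) atTop (𝓝 0)

/-- `i` is an ergodic index of the deterministic chain `A`. -/
def ErgodicIndex {m : ℕ} (A : ℕ → Matrix (Fin m) (Fin m) ℝ) (i : Fin m) : Prop :=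
  ∀ (t₀ : ℕ) (x : ℕ → Fin m → ℝ), IsTrajectory A t₀ x →
    ∃ l : ℝ, Tendsto (fun k => x k i) atTop (𝓝 l)

/-- The deterministic chain `A` is stable. -/
def Stable {m : ℕ} (A : ℕ → Matrix (Fin m) (Fin m) ℝ) : Prop :=
  ∀ i, ErgodicIndex A i

/-- The relation `i ↔ j` of a random chain (mutual weak ergodicity almost surely).
Its equivalence classes are the ergodicity classes of the random chain. -/
def ergodicitySetoid {Ω : Type*} [MeasurableSpace Ω] (μ : Measure Ω) {m : ℕ}
    (W : ℕ → Ω → Matrix (Fin m) (Fin m) ℝ) : Setoid (Fin m) where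
  r i j := ∀ᵐ ω ∂μ, MutuallyWeaklyErgodic (fun k => W k ω) i j
  iseqv :=
    { refl := fun i => Eventually.of_forall fun ω t₀ x _ => by simp
      symm := fun {i j} h => by
        filter_upwards [h] with ω hω t₀ x hx
        simpa using (hω t₀ x hx).neg
      trans := fun {i j l} h h' => by
        filter_upwards [h, h'] with ω hω hω' t₀ x hx
        simpa using (hω t₀ x hx).add (hω' t₀ x hx) }

/-- The infinite flow graph of a random chain: `{i, j}` is a link iff `i ≠ j` and
`∑ₖ (Wᵢⱼ(k) + Wⱼᵢ(k)) = ∞` almost surely. -/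
def infiniteFlowGraph {Ω : Type*} [MeasurableSpace Ω] (μ : Measure Ω) {m : ℕ}
    (W : ℕ → Ω → Matrix (Fin m) (Fin m) ℝ) : SimpleGraph (Fin m) where
  Adj i j := i ≠ j ∧ ∀ᵐ ω ∂μ,
    Tendsto (fun n => ∑ k ∈ Finset.range n, (W k ω i j + W k ω j i)) atTop atTop
  symm := ⟨fun i j h => ⟨h.1.symm, by simpa only [add_comm] using h.2⟩⟩
  loopless := ⟨fun _ h => h.1 rfl⟩

open scoped Classical in
/-- The update matrix when agent `i` broadcasts over the graph `G` with mixing parameter `c`: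
`I - c ∑_{j ∈ N_i} e_j (e_j - e_i)ᵀ`, with `N_i` the set of neighbours of `i` in `G`. -/
noncomputable def broadcastMatrix {m : ℕ} (G : SimpleGraph (Fin m)) (c : ℝ) (i : Fin m) :
    Matrix (Fin m) (Fin m) ℝ :=
  1 - c • ∑ j ∈ Finset.univ.filter (fun j => G.Adj i j),
    Matrix.vecMulVec (Pi.single j (1 : ℝ)) (Pi.single j (1 : ℝ) - Pi.single i (1 : ℝ))

/-- The time-varying broadcast gossip model: at time `k` the agent `a k ω` broadcasts over the
graph `G k` with mixing parameter `c k`. -/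
noncomputable def broadcastGossip {Ω : Type*} {m : ℕ} (G : ℕ → SimpleGraph (Fin m)) (c : ℕ → ℝ)
    (a : ℕ → Ω → Fin m) (k : ℕ) (ω : Ω) : Matrix (Fin m) (Fin m) ℝ :=
  broadcastMatrix (G k) (c k) (a k ω)

end RandomChain

/-! The graphs are undirected and the broadcaster is uniform, so exchanges along edges cancel on
average: for convex `g` the sum of `g (x j)` over the agents is a bounded supermartingale
(`ae_exists_tendsto_sum_convexOn_gossipState`). This is used for two kinds of `g`.

For `g = (·)^2` the loss is explicit. Since `1 - c k ≥ 1 - γ > 0`, the energy `c k * ∑ (x i - x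
j)^2` over the edges is almost surely summable in `k`, so increments tend to `0`. For `g = |· - q|`
with `q` rational, the sums of distances to every `q` converge. Together these force each agent to
converge: an agent oscillating across an interval would cross many disjoint windows infinitely
often, and convergence of the tent sums would then keep every window occupied by some agent, with
more windows than agents (`not_upcrossing_of_tendsto_sum_abs`).

If the weights `c k` at the times when `{i, j}` is an edge have infinite sum, finite energy forces
the limits of `i` and `j` to agree. If the weights across a cut have finite sum, a late start from
the indicator of one side keeps the two sides apart in every realization. A conditional
Borel–Cantelli argument identifies the edges of infinite weight with those of the infinite flow
graph. -/

/-! ### Deterministic convergence criteria -/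

/-- A real sequence with vanishing increments that is frequently below `a` and frequently above `b`
is frequently between `a` and `b`. -/
theorem frequently_mem_Ioo_of_tendsto_sub_zero {u : ℕ → ℝ} {a b : ℝ} (hab : a < b)
    (hu : Tendsto (fun k => u (k + 1) - u k) atTop (𝓝 0))
    (ha : ∃ᶠ n in atTop, u n < a) (hb : ∃ᶠ n in atTop, b < u n) :
    ∃ᶠ n in atTop, u n ∈ Set.Ioo a b := by
  rw [frequently_atTop]
  intro N
  have hev : ∀ᶠ k in atTop, u (k + 1) - u k < b - a := hu.eventually_lt_const (by linarith)
  obtain ⟨N₁, hN₁⟩ := eventually_atTop.1 hev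
  obtain ⟨n, hn, hna⟩ := frequently_atTop.1 ha (max N N₁)
  obtain ⟨p, hp, hpb⟩ := frequently_atTop.1 hb n
  -- At the first time after `n` with value above `a`, the preceding value is at most `a`, and a
  -- step shorter than `b - a` cannot jump past `b`.
  have hex : ∃ d, a < u (n + d) := ⟨p - n, by
    rw [Nat.add_sub_cancel' hp]; exact hab.trans hpb⟩
  classical
  obtain ⟨d, hd⟩ : ∃ d, d = Nat.find hex := ⟨_, rfl⟩
  have hspec : a < u (n + d) := hd ▸ Nat.find_spec hex
  have hd0 : d ≠ 0 := by
    rintro rfl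
    simp only [add_zero] at hspec
    linarith
  obtain ⟨e, rfl⟩ := Nat.exists_eq_succ_of_ne_zero hd0
  have hmin : ¬ a < u (n + e) := Nat.find_min hex (by omega)
  have hstep := hN₁ (n + e) (by have := le_max_right N N₁; omega)
  refine ⟨n + (e + 1), by have := le_max_left N N₁; omega, hspec, ?_⟩
  have : u (n + (e + 1)) = u (n + e + 1) := rfl
  rw [this]
  linarith [not_lt.1 hmin]

/-- The tent of half-width `h` around `q` is nonnegative. -/
theorem tent_nonneg (x q h : ℝ) : 0 ≤ |x - (q + h)| + |x - (q - h)| - 2 * |x - q| := by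
  have := abs_add_le (x - (q + h)) (x - (q - h))
  have h2 : x - (q + h) + (x - (q - h)) = 2 * (x - q) := by ring
  rw [h2, abs_mul, abs_two] at this
  linarith

/-- The tent of half-width `h` around `q` is supported in `(q - h, q + h)`. -/
theorem mem_Ioo_of_tent_pos {x q h : ℝ} (hh : 0 ≤ h)
    (hx : 0 < |x - (q + h)| + |x - (q - h)| - 2 * |x - q|) : x ∈ Set.Ioo (q - h) (q + h) := by
  by_contra hn
  rw [Set.mem_Ioo, not_and_or, not_lt, not_lt] at hn
  rcases hn with hn | hn
  · rw [abs_of_nonpos (by linarith : x - (q + h) ≤ 0), abs_of_nonpos (by linarith : x - (q - h) ≤ 0),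
      abs_of_nonpos (by linarith : x - q ≤ 0)] at hx
    linarith
  · rw [abs_of_nonneg (by linarith : 0 ≤ x - (q + h)), abs_of_nonneg (by linarith : 0 ≤ x - (q - h)),
      abs_of_nonneg (by linarith : 0 ≤ x - q)] at hx
    linarith

/-- The tent of half-width `h` around `q` is at least `h` on `(q - h / 2, q + h / 2)`. -/
theorem le_tent_of_mem_Ioo {x q h : ℝ} (hx : x ∈ Set.Ioo (q - h / 2) (q + h / 2)) :
    h ≤ |x - (q + h)| + |x - (q - h)| - 2 * |x - q| := by
  obtain ⟨h1, h2⟩ := hx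
  have : |x - q| ≤ h / 2 := abs_le.2 ⟨by linarith, by linarith⟩
  have h3 := neg_abs_le (x - (q + h))
  have h4 := le_abs_self (x - (q - h))
  linarith

/-- If finitely many real sequences have vanishing increments and the sums of their distances to
each rational converge, then none of them oscillates across a rational interval. -/
theorem not_upcrossing_of_tendsto_sum_abs {ι : Type*} [Fintype ι] {x : ℕ → ι → ℝ}
    (hinc : ∀ i, Tendsto (fun k => x (k + 1) i - x k i) atTop (𝓝 0))
    (hconv : ∀ q : ℚ, ∃ l : ℝ, Tendsto (fun k => ∑ i, |x k i - q|) atTop (𝓝 l))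
    (i : ι) (a b : ℚ) (hab : a < b) :
    ¬((∃ᶠ n in atTop, x n i < a) ∧ ∃ᶠ n in atTop, (b : ℝ) < x n i) := by
  rintro ⟨ha, hb⟩
  -- One window more than there are agents: `(a, b)` is cut into `N` disjoint windows of half-width
  -- `h`, centred at the `q r`.
  obtain ⟨N, hN⟩ : ∃ N : ℕ, N = Fintype.card ι + 1 := ⟨_, rfl⟩
  have hN0 : (0 : ℚ) < N := by rw [hN]; positivity
  obtain ⟨h, hh⟩ : ∃ h : ℚ, h = (b - a) / (2 * N) := ⟨_, rfl⟩
  have hpos : 0 < h := by rw [hh]; exact div_pos (by linarith) (by linarith)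
  have hposR : (0 : ℝ) < h := by exact_mod_cast hpos
  have hmul : 2 * N * h = b - a := by rw [hh]; field_simp
  let q : Fin N → ℚ := fun r => a + (2 * r + 1) * h
  have key : ∀ r : Fin N, ∀ᶠ k in atTop, ∃ j, x k j ∈ Set.Ioo ((q r : ℝ) - h) (q r + h) := by
    intro r
    have hrN : ((r : ℕ) : ℚ) + 1 ≤ N := by exact_mod_cast r.2
    have hq1 : a ≤ q r - h := by
      have : (0 : ℚ) ≤ (r : ℕ) * h := by positivity
      simp only [q]; linarith
    have hq2 : q r + h ≤ b := by
      have : (((r : ℕ) : ℚ) + 1) * h ≤ N * h := mul_le_mul_of_nonneg_right hrN hpos.le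
      simp only [q]; linarith
    have hq1' : (a : ℝ) ≤ q r - h := by exact_mod_cast hq1
    have hq2' : (q r : ℝ) + h ≤ b := by exact_mod_cast hq2
    have hfr : ∃ᶠ n in atTop, x n i ∈ Set.Ioo ((q r : ℝ) - h / 2) (q r + h / 2) :=
      frequently_mem_Ioo_of_tendsto_sub_zero (by linarith) (hinc i)
        (ha.mono fun n hn => by linarith) (hb.mono fun n hn => by linarith)
    obtain ⟨l₁, hl₁⟩ := hconv (q r + h)
    obtain ⟨l₂, hl₂⟩ := hconv (q r - h)
    obtain ⟨l₃, hl₃⟩ := hconv (q r)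
    have hlim : Tendsto (fun k => ∑ j, (|x k j - (q r + h)| + |x k j - (q r - h)|
        - 2 * |x k j - q r|)) atTop (𝓝 (l₁ + l₂ - 2 * l₃)) := by
      have := (hl₁.add hl₂).sub (hl₃.const_mul 2)
      refine this.congr fun k => ?_
      rw [Finset.sum_sub_distrib, Finset.sum_add_distrib, Finset.mul_sum]
      push_cast
      rfl
    -- The oscillating agent lifts the tent sum to at least `h` infinitely often, and the sum
    -- converges. So it is eventually positive at all times, and some agent, perhaps a varying one,
    -- is always in the window.
    have hl : (h : ℝ) ≤ l₁ + l₂ - 2 * l₃ := by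
      refine ge_of_tendsto_of_frequently hlim (hfr.mono fun n hn => ?_)
      exact (le_tent_of_mem_Ioo hn).trans (Finset.single_le_sum
        (f := fun j => |x n j - (q r + h)| + |x n j - (q r - h)| - 2 * |x n j - q r|)
        (fun j _ => tent_nonneg _ _ _) (Finset.mem_univ i))
    filter_upwards [hlim.eventually_const_lt (hposR.trans_le hl)] with k hk
    obtain ⟨j, -, hj⟩ := Finset.exists_lt_of_sum_lt
      (s := Finset.univ) ((Finset.sum_const_zero (ι := ι)).trans_lt hk)
    exact ⟨j, mem_Ioo_of_tent_pos hposR.le hj⟩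
  obtain ⟨k, hk⟩ := (eventually_all.2 key).exists
  choose f hf using hk
  obtain ⟨r, s, hrs, hfrs⟩ := Fintype.exists_ne_map_eq_of_card_lt f (by simp [hN])
  wlog hlt : r < s generalizing r s
  · exact this s r hrs.symm hfrs.symm (lt_of_le_of_ne (not_lt.1 hlt) hrs.symm)
  have h1 := (hf r).2
  have h2 := (hf s).1
  rw [hfrs] at h1
  have h3 : ((r : ℕ) : ℝ) + 1 ≤ (s : ℕ) := by exact_mod_cast hlt
  have h4 := mul_le_mul_of_nonneg_right h3 hposR.le
  simp only [q] at h1 h2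
  push_cast at h1 h2
  linarith

/-- If finitely many bounded real sequences have vanishing increments and the sums of their
distances to each rational converge, then each of them converges. -/
theorem exists_tendsto_of_tendsto_sum_abs {ι : Type*} [Fintype ι] {x : ℕ → ι → ℝ} {B : ℝ}
    (hB : ∀ k i, |x k i| ≤ B)
    (hinc : ∀ i, Tendsto (fun k => x (k + 1) i - x k i) atTop (𝓝 0))
    (hconv : ∀ q : ℚ, ∃ l : ℝ, Tendsto (fun k => ∑ i, |x k i - q|) atTop (𝓝 l)) (i : ι) :
    ∃ l : ℝ, Tendsto (fun k => x k i) atTop (𝓝 l) := by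
  refine tendsto_of_no_upcrossings Rat.denseRange_cast ?_
    (isBoundedUnder_of ⟨B, fun k => (abs_le.1 (hB k i)).2⟩)
    (isBoundedUnder_of ⟨-B, fun k => (abs_le.1 (hB k i)).1⟩)
  rintro _ ⟨a, rfl⟩ _ ⟨b, rfl⟩ hab
  exact not_upcrossing_of_tendsto_sum_abs hinc hconv i a b (by exact_mod_cast hab)

/-- If `u` converges, `w ≥ 0` is not summable and `w * u ^ 2` is summable, then `u` tends to `0`. -/
theorem tendsto_zero_of_summable_mul_sq {u w : ℕ → ℝ} {l : ℝ} (hu : Tendsto u atTop (𝓝 l))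
    (hw : ∀ k, 0 ≤ w k) (hdiv : ¬ Summable w) (hsum : Summable fun k => w k * u k ^ 2) :
    Tendsto u atTop (𝓝 0) := by
  suffices l = 0 by rwa [this] at hu
  by_contra hl
  refine hdiv ?_
  have hl2 : 0 < l ^ 2 / 2 := by positivity
  have hev : ∀ᶠ k in atTop, l ^ 2 / 2 < u k ^ 2 :=
    (hu.pow 2).eventually_const_lt (by linarith)
  refine Summable.of_norm_bounded_eventually_nat (hsum.mul_left (l ^ 2 / 2)⁻¹) ?_
  filter_upwards [hev] with k hk
  rw [Real.norm_eq_abs, abs_of_nonneg (hw k), le_inv_mul_iff₀ hl2, mul_comm]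
  exact mul_le_mul_of_nonneg_left hk.le (hw k)

/-! ### One step of the dynamics, summed over the broadcaster -/

namespace RandomChain

variable {m : ℕ}

open scoped Classical in
theorem broadcastMatrix_mulVec (G : SimpleGraph (Fin m)) (c : ℝ) (i j : Fin m) (x : Fin m → ℝ) :
    (broadcastMatrix G c i *ᵥ x) j = if G.Adj i j then (1 - c) * x j + c * x i else x j := by
  have : ∀ l, (Matrix.vecMulVec (Pi.single l (1 : ℝ))
      (Pi.single l (1 : ℝ) - Pi.single i (1 : ℝ)) *ᵥ x) j = if j = l then x l - x i else 0 := by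
    intro l
    rw [Matrix.vecMulVec_mulVec]
    simp [sub_dotProduct, Pi.single_apply]
  rw [broadcastMatrix, Matrix.sub_mulVec, Matrix.one_mulVec, Matrix.smul_mulVec,
    Matrix.sum_mulVec]
  simp only [Pi.sub_apply, Pi.smul_apply, Finset.sum_apply, this, smul_eq_mul,
    Finset.sum_ite_eq, Finset.mem_filter, Finset.mem_univ, true_and]
  split_ifs <;> ring

open scoped Classical in
theorem broadcastMatrix_apply_of_ne (G : SimpleGraph (Fin m)) (c : ℝ) (i : Fin m) {j l : Fin m}
    (hjl : j ≠ l) : broadcastMatrix G c i j l = if G.Adj j l ∧ i = l then c else 0 := by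
  have h := broadcastMatrix_mulVec G c i j (Pi.single l 1)
  rw [Matrix.mulVec_single_one, Matrix.col_apply] at h
  rw [h]
  by_cases hil : i = l
  · subst hil
    simp [hjl, G.adj_comm]
  · simp [hjl, hil]

theorem abs_broadcastMatrix_mulVec_le (G : SimpleGraph (Fin m)) {c : ℝ} (hc : c ∈ Set.Icc (0 : ℝ) 1)
    (i : Fin m) {x : Fin m → ℝ} {B : ℝ} (hx : ∀ j, |x j| ≤ B) (j : Fin m) :
    |(broadcastMatrix G c i *ᵥ x) j| ≤ B := by
  classical
  rw [broadcastMatrix_mulVec]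
  split_ifs
  · obtain ⟨h0, h1⟩ := hc
    calc |(1 - c) * x j + c * x i| ≤ |(1 - c) * x j| + |c * x i| := abs_add_le _ _
      _ = (1 - c) * |x j| + c * |x i| := by
        rw [abs_mul, abs_mul, abs_of_nonneg h0, abs_of_nonneg (sub_nonneg.2 h1)]
      _ ≤ (1 - c) * B + c * B := by
        gcongr
        · exact hx j
        · exact hx i
      _ = B := by ring
  · exact hx j

open scoped Classical in
/-- The total exchange along the edges of a graph cancels. -/
theorem sum_sum_adj_mul_sub (G : SimpleGraph (Fin m)) (c : ℝ) (f : Fin m → ℝ) :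
    ∑ i, ∑ j, (if G.Adj i j then c * (f i - f j) else 0) = 0 := by
  have h : ∑ i, ∑ j, (if G.Adj i j then c * (f i - f j) else 0)
      = -∑ i, ∑ j, (if G.Adj i j then c * (f i - f j) else 0) := by
    conv_lhs => rw [Finset.sum_comm]
    rw [← Finset.sum_neg_distrib]
    refine Finset.sum_congr rfl fun i _ => ?_
    rw [← Finset.sum_neg_distrib]
    refine Finset.sum_congr rfl fun j _ => ?_
    rw [G.adj_comm]
    split_ifs <;> ring
  linarith

/-- Convexity bounds the change at a neighbour `j` of `i` by `c * (g (x i) - g (x j))`, which is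
antisymmetric in the edge. Summing over `i` stands for averaging over the broadcaster. -/
theorem sum_sum_convexOn_broadcastMatrix_mulVec_le (G : SimpleGraph (Fin m)) {c : ℝ}
    (hc : c ∈ Set.Icc (0 : ℝ) 1) {g : ℝ → ℝ} (hg : ConvexOn ℝ Set.univ g) (x : Fin m → ℝ) :
    ∑ i, ∑ j, g ((broadcastMatrix G c i *ᵥ x) j) ≤ m * ∑ j, g (x j) := by
  classical
  calc ∑ i, ∑ j, g ((broadcastMatrix G c i *ᵥ x) j)
      ≤ ∑ i, ∑ j, (g (x j) + if G.Adj i j then c * (g (x i) - g (x j)) else 0) := by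
        refine Finset.sum_le_sum fun i _ => Finset.sum_le_sum fun j _ => ?_
        rw [broadcastMatrix_mulVec]
        split_ifs
        · have := hg.2 (Set.mem_univ (x j)) (Set.mem_univ (x i)) (sub_nonneg.2 hc.2) hc.1
            (by ring)
          simp only [smul_eq_mul] at this
          linarith
        · simp
    _ = m * ∑ j, g (x j) := by
        simp only [Finset.sum_add_distrib, sum_sum_adj_mul_sub G c (fun i => g (x i))]
        simp

-- For the square, the convexity defect of a single update is exactly `c * (1 - c) * (x i - x j) ^
-- 2`.
open scoped Classical in
theorem sum_sum_sq_broadcastMatrix_mulVec (G : SimpleGraph (Fin m)) (c : ℝ) (x : Fin m → ℝ) :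
    ∑ i, ∑ j, (broadcastMatrix G c i *ᵥ x) j ^ 2 = m * ∑ j, x j ^ 2
      - c * (1 - c) * ∑ i, ∑ j, (if G.Adj i j then (x i - x j) ^ 2 else 0) := by
  have h : ∀ i j, (broadcastMatrix G c i *ᵥ x) j ^ 2 = (x j ^ 2
      + if G.Adj i j then c * (x i ^ 2 - x j ^ 2) else 0)
      - c * (1 - c) * (if G.Adj i j then (x i - x j) ^ 2 else 0) := by
    intro i j
    rw [broadcastMatrix_mulVec]
    split_ifs <;> ring
  simp only [h, Finset.sum_add_distrib, Finset.sum_sub_distrib,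
    sum_sum_adj_mul_sub G c (fun i => x i ^ 2), ← Finset.mul_sum]
  simp

end RandomChain

/-- Nonnegative integrable functions with summable integrals are almost everywhere summable. -/
theorem ae_summable_of_summable_integral {Ω : Type*} [MeasurableSpace Ω] {μ : Measure Ω}
    {f : ℕ → Ω → ℝ} (hf : ∀ k, Integrable (f k) μ) (hf0 : ∀ k ω, 0 ≤ f k ω)
    (hsum : Summable fun k => ∫ ω, f k ω ∂μ) : ∀ᵐ ω ∂μ, Summable fun k => f k ω := by
  have hmeas : ∀ k, AEMeasurable (fun ω => ENNReal.ofReal (f k ω)) μ :=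
    fun k => (hf k).aestronglyMeasurable.aemeasurable.ennreal_ofReal
  have hfin : ∫⁻ ω, ∑' k, ENNReal.ofReal (f k ω) ∂μ ≠ ∞ := by
    rw [lintegral_tsum hmeas]
    have : ∀ k, ∫⁻ ω, ENNReal.ofReal (f k ω) ∂μ = ENNReal.ofReal (∫ ω, f k ω ∂μ) := fun k =>
      (ofReal_integral_eq_lintegral_ofReal (hf k) (Eventually.of_forall (hf0 k))).symm
    simp only [this]
    exact hsum.tsum_ofReal_ne_top
  filter_upwards [ae_lt_top' (AEMeasurable.tsum hmeas) hfin] with ω hω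
  have := ENNReal.summable_toReal hω.ne
  simpa only [ENNReal.toReal_ofReal (hf0 _ ω)] using this

namespace RandomChain

variable {Ω : Type*} {m : ℕ}

/-! ### Pathwise estimates and the cut argument -/

section State

/-- The state at time `k` of the broadcast gossip dynamics started from `v` at time `0`. -/
noncomputable def gossipState (G : ℕ → SimpleGraph (Fin m)) (c : ℕ → ℝ) (a : ℕ → Ω → Fin m)
    (v : Fin m → ℝ) : ℕ → Ω → Fin m → ℝ
  | 0, _ => v
  | k + 1, ω => broadcastGossip G c a k ω *ᵥ gossipState G c a v k ω

variable (G : ℕ → SimpleGraph (Fin m)) (c : ℕ → ℝ) (a : ℕ → Ω → Fin m)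

theorem abs_gossipState_le (hc : ∀ k, c k ∈ Set.Icc (0 : ℝ) 1) (v : Fin m → ℝ) (k : ℕ) (ω : Ω)
    (j : Fin m) : |gossipState G c a v k ω j| ≤ ‖v‖ := by
  induction k generalizing j with
  | zero => exact norm_le_pi_norm v j
  | succ k ih => exact abs_broadcastMatrix_mulVec_le (G k) (hc k) _ ih j

/-- By linearity, the uncountably many trajectories reduce to countably many states, indexed by `t₀`
and a basis vector, so a single null set serves for all of them, even when `x t₀` depends on `ω`. -/
theorem IsTrajectory.eq_sum_gossipState {t₀ : ℕ} {ω : Ω} {x : ℕ → Fin m → ℝ}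
    (hx : IsTrajectory (fun k => broadcastGossip G c a k ω) t₀ x) (n : ℕ) :
    x (t₀ + n) = ∑ l, x t₀ l • gossipState (fun k => G (t₀ + k)) (fun k => c (t₀ + k))
      (fun k => a (t₀ + k)) (Pi.single l 1) n ω := by
  induction n with
  | zero =>
    simp only [gossipState, add_zero]
    ext i
    simp [Finset.sum_apply, Pi.single_apply]
  | succ n ih =>
    have h := hx (t₀ + n) (Nat.le_add_right _ _)
    rw [← add_assoc, h, ih, Matrix.mulVec_sum]
    refine Finset.sum_congr rfl fun l _ => ?_
    rw [Matrix.mulVec_smul]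
    rfl

theorem isTrajectory_gossipState (t₀ : ℕ) (v : Fin m → ℝ) (ω : Ω) :
    IsTrajectory (fun k => broadcastGossip G c a k ω) t₀
      (fun k => gossipState (fun n => G (t₀ + n)) (fun n => c (t₀ + n)) (fun n => a (t₀ + n)) v
        (k - t₀) ω) := by
  intro k hk
  obtain ⟨n, rfl⟩ := Nat.exists_eq_add_of_le hk
  have : t₀ + n + 1 - t₀ = n + 1 := by omega
  simp only [this, Nat.add_sub_cancel_left]
  rfl

open scoped Classical in
/-- Starting from the indicator of `S`, the agents in `S` lose, and those outside of `S` gain, at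
most the accumulated weight of the steps at which an edge leaves `S`. -/
theorem gossipState_indicator_bounds (hc : ∀ k, c k ∈ Set.Icc (0 : ℝ) 1) (S : Set (Fin m))
    (ω : Ω) (n : ℕ) :
    (∀ j, gossipState G c a (S.indicator 1) n ω j ∈ Set.Icc (0 : ℝ) 1) ∧
    (∀ i ∈ S, 1 - ∑ k ∈ Finset.range n, (if ∃ i ∈ S, ∃ j ∉ S, (G k).Adj i j then c k else 0)
      ≤ gossipState G c a (S.indicator 1) n ω i) ∧
    (∀ j ∉ S, gossipState G c a (S.indicator 1) n ω j
      ≤ ∑ k ∈ Finset.range n, (if ∃ i ∈ S, ∃ j ∉ S, (G k).Adj i j then c k else 0)) := by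
  induction n with
  | zero =>
    refine ⟨fun j => ?_, fun i hi => ?_, fun j hj => ?_⟩
    · by_cases hj : j ∈ S <;> simp [gossipState, hj]
    · simp [gossipState, hi]
    · simp [gossipState, hj]
  | succ n ih =>
    obtain ⟨ih0, ih1, ih2⟩ := ih
    obtain ⟨h0, h1⟩ := hc n
    have hstep : ∀ j, gossipState G c a (S.indicator 1) (n + 1) ω j =
        if (G n).Adj (a n ω) j then (1 - c n) * gossipState G c a (S.indicator 1) n ω j
          + c n * gossipState G c a (S.indicator 1) n ω (a n ω)
        else gossipState G c a (S.indicator 1) n ω j :=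
      fun j => broadcastMatrix_mulVec (G n) (c n) (a n ω) j _
    generalize gossipState G c a (S.indicator 1) n ω = y at ih0 ih1 ih2 hstep
    have hw : 0 ≤ if ∃ i ∈ S, ∃ j ∉ S, (G n).Adj i j then c n else 0 := by
      split_ifs
      · exact h0
      · exact le_rfl
    simp only [Finset.sum_range_succ]
    generalize ∑ k ∈ Finset.range n, (if ∃ i ∈ S, ∃ j ∉ S, (G k).Adj i j then c k else 0) = s at *
    have hc1 : 0 ≤ 1 - c n := by linarith
    refine ⟨fun j => ?_, fun i hi => ?_, fun j hj => ?_⟩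
    · rw [hstep]
      split_ifs
      · exact (convex_Icc (0 : ℝ) 1) (ih0 j) (ih0 (a n ω)) hc1 h0 (by ring)
      · exact ih0 j
    · rw [hstep]
      split_ifs with hcross hadj hadj
      -- A step with an edge across the cut costs at most `c n` because the values lie in `[0, 1]`.
      -- Without such an edge, a broadcaster adjacent to `i` lies in `S` too, and averaging
      -- preserves the bound.
      · have h2 := mul_nonneg h0 (ih0 (a n ω)).1
        have h3 := mul_le_mul_of_nonneg_left (ih0 i).2 h0
        linarith [ih1 i hi]
      · linarith [ih1 i hi]
      · have haS : a n ω ∈ S := by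
          by_contra haS
          exact hcross ⟨i, hi, _, haS, hadj.symm⟩
        have h2 := mul_le_mul_of_nonneg_left (ih1 i hi) hc1
        have h3 := mul_le_mul_of_nonneg_left (ih1 _ haS) h0
        linarith
      · linarith [ih1 i hi]
    · rw [hstep]
      split_ifs with hadj hcross hcross
      · have h2 := mul_le_mul_of_nonneg_left (ih0 (a n ω)).2 h0
        have h3 := mul_nonneg h0 (ih0 j).1
        linarith [ih2 j hj]
      · have haS : a n ω ∉ S := fun haS => hcross ⟨_, haS, j, hj, hadj⟩
        have h2 := mul_le_mul_of_nonneg_left (ih2 j hj) hc1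
        have h3 := mul_le_mul_of_nonneg_left (ih2 _ haS) h0
        linarith
      · linarith [ih2 j hj]
      · linarith [ih2 j hj]

open scoped Classical in
/-- If the steps at which an edge leaves `S` have summable weight, then no agent of `S` is mutually
weakly ergodic with an agent outside of `S`, in any realization. -/
theorem not_mutuallyWeaklyErgodic_of_summable (hc : ∀ k, c k ∈ Set.Icc (0 : ℝ) 1)
    {S : Set (Fin m)}
    (hS : Summable fun k => if ∃ i ∈ S, ∃ j ∉ S, (G k).Adj i j then c k else 0)
    {i j : Fin m} (hi : i ∈ S) (hj : j ∉ S) (ω : Ω) :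
    ¬ MutuallyWeaklyErgodic (fun k => broadcastGossip G c a k ω) i j := by
  intro hmwe
  have hpos : ∀ k, 0 ≤ if ∃ i ∈ S, ∃ j ∉ S, (G k).Adj i j then c k else 0 := by
    intro k
    split_ifs
    · exact (hc k).1
    · exact le_rfl
  -- With a tail below `1 / 4`, agents of `S` stay above `3 / 4` and the others below `1 / 4`, a gap
  -- of at least `1 / 2`.
  obtain ⟨t₀, ht₀⟩ := ((tendsto_sum_nat_add fun k =>
    if ∃ i ∈ S, ∃ j ∉ S, (G k).Adj i j then c k else 0).eventually_lt_const
      (by norm_num : (0 : ℝ) < 1 / 4)).exists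
  have hlim := hmwe t₀ _ (isTrajectory_gossipState G c a t₀ (S.indicator 1) ω)
  have hge : (1 / 2 : ℝ) ≤ 0 := by
    refine ge_of_tendsto hlim (eventually_ge_atTop t₀ |>.mono fun k hk => ?_)
    obtain ⟨n, rfl⟩ := Nat.exists_eq_add_of_le hk
    simp only [Nat.add_sub_cancel_left]
    obtain ⟨-, h1, h2⟩ := gossipState_indicator_bounds (fun n => G (t₀ + n)) (fun n => c (t₀ + n))
      (fun n => a (t₀ + n)) (fun n => hc _) S ω n
    have hle : ∑ k ∈ Finset.range n,
        (if ∃ i ∈ S, ∃ j ∉ S, (G (t₀ + k)).Adj i j then c (t₀ + k) else 0) ≤ 1 / 4 := by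
      refine le_trans ?_ ht₀.le
      simp only [add_comm t₀]
      exact Summable.sum_le_tsum _ (fun k _ => hpos _) ((summable_nat_add_iff t₀).2 hS)
    linarith [h1 i hi, h2 j hj]
  norm_num at hge

-- An increment is `0` or `c k` times a difference along an edge, and `c k ^ 2 ≤ c k`; summable
-- energy therefore makes increments vanish.
open scoped Classical in
theorem sq_sub_gossipState_succ_le (hc : ∀ k, c k ∈ Set.Icc (0 : ℝ) 1) (v : Fin m → ℝ) (k : ℕ)
    (ω : Ω) (j : Fin m) :
    (gossipState G c a v (k + 1) ω j - gossipState G c a v k ω j) ^ 2 ≤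
      c k * ∑ i, ∑ j, (if (G k).Adj i j then
        (gossipState G c a v k ω i - gossipState G c a v k ω j) ^ 2 else 0) := by
  have hstep : gossipState G c a v (k + 1) ω j = _ :=
    broadcastMatrix_mulVec (G k) (c k) (a k ω) j _
  rw [hstep]
  generalize gossipState G c a v k ω = y
  obtain ⟨h0, h1⟩ := hc k
  have hnn : ∀ i j, 0 ≤ if (G k).Adj i j then (y i - y j) ^ 2 else 0 := fun i j => by
    split_ifs <;> positivity
  have hle : (if (G k).Adj (a k ω) j then (y (a k ω) - y j) ^ 2 else 0) ≤
      ∑ i, ∑ j, if (G k).Adj i j then (y i - y j) ^ 2 else 0 :=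
    (Finset.single_le_sum (f := fun j => if (G k).Adj (a k ω) j then (y (a k ω) - y j) ^ 2 else 0)
      (fun j _ => hnn _ j) (Finset.mem_univ j)).trans
    (Finset.single_le_sum (f := fun i => ∑ j, if (G k).Adj i j then (y i - y j) ^ 2 else 0)
      (fun i _ => Finset.sum_nonneg fun j _ => hnn i j) (Finset.mem_univ (a k ω)))
  refine le_trans ?_ (mul_le_mul_of_nonneg_left hle h0)
  split_ifs
  · have : ((1 - c k) * y j + c k * y (a k ω) - y j) ^ 2 = c k * (c k * (y (a k ω) - y j) ^ 2) := by
      ring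
    rw [this]
    exact mul_le_mul_of_nonneg_left (mul_le_of_le_one_left (sq_nonneg _) h1) h0
  · simp

end State

/-! ### Supermartingales, energy and conditional Borel–Cantelli -/

section Probability

variable [mΩ : MeasurableSpace Ω] {μ : Measure Ω}

/-- The `σ`-algebra at time `k` is generated by the agents waking up before time `k`. -/
def pastFiltration (a : ℕ → Ω → Fin m) (ha : ∀ k, Measurable (a k)) : Filtration ℕ mΩ where
  seq k := ⨆ j ∈ Set.Iio k, MeasurableSpace.comap (a j) inferInstance
  mono' _ _ h := biSup_mono fun _ hj => lt_of_lt_of_le hj h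
  le' _ := iSup₂_le fun j _ => (ha j).comap_le

variable {a : ℕ → Ω → Fin m} (ha : ∀ k, Measurable (a k))

theorem measurable_agent_pastFiltration {j k : ℕ} (hjk : j < k) :
    Measurable[pastFiltration a ha k] (a j) :=
  (comap_measurable (a j)).mono
    (le_iSup₂_of_le (f := fun j (_ : j ∈ Set.Iio k) => MeasurableSpace.comap (a j) inferInstance)
      j hjk le_rfl) le_rfl

theorem indep_comap_agent_pastFiltration (hindep : iIndepFun a μ) (k : ℕ) :
    Indep (MeasurableSpace.comap (a k) inferInstance) (pastFiltration a ha k) μ := by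
  have h := indep_iSup_of_disjoint (fun j => (ha j).comap_le) hindep.iIndep
    (S := {k}) (T := Set.Iio k) (by simp)
  rwa [iSup_singleton] at h

variable [IsProbabilityMeasure μ]

/-- Averaging over the agent that wakes up at time `k`, given the past. -/
theorem condExp_agent_comp (hindep : iIndepFun a μ)
    (hunif : ∀ k i, μ {ω | a k ω = i} = (m : ℝ≥0∞)⁻¹) (k : ℕ) {h : Fin m → Ω → ℝ}
    (hh : ∀ i, StronglyMeasurable[pastFiltration a ha k] (h i)) {C : ℝ}
    (hC : ∀ i ω, |h i ω| ≤ C) :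
    μ[fun ω => h (a k ω) ω | pastFiltration a ha k] =ᵐ[μ] fun ω => (m : ℝ)⁻¹ * ∑ i, h i ω := by
  have hset : ∀ i, MeasurableSet {ω | a k ω = i} := fun i => ha k (measurableSet_singleton i)
  -- Splitting by the value of `a k` separates a factor known from the past from an indicator
  -- independent of it.
  let e : Fin m → Ω → ℝ := fun i => {ω | a k ω = i}.indicator 1
  have heint : ∀ i, Integrable (e i) μ := fun i => (integrable_const (1 : ℝ)).indicator (hset i)
  have hbd : ∀ i, ∀ᵐ ω ∂μ, ‖h i ω‖ ≤ C := fun i => Eventually.of_forall (hC i)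
  have hint : ∀ i, Integrable (h i * e i) μ := fun i =>
    (heint i).bdd_mul ((hh i).mono ((pastFiltration a ha).le k)).aestronglyMeasurable (hbd i)
  have heq : (fun ω => h (a k ω) ω) = ∑ i, h i * e i := by
    ext ω
    simp [e, Finset.sum_apply, Set.indicator_apply]
  have he : ∀ i, μ[e i | pastFiltration a ha k] =ᵐ[μ] fun _ => (m : ℝ)⁻¹ := by
    intro i
    have hm : StronglyMeasurable[MeasurableSpace.comap (a k) inferInstance] (e i) :=
      StronglyMeasurable.indicator stronglyMeasurable_one
        ⟨{i}, measurableSet_singleton i, rfl⟩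
    refine (condExp_indep_eq (ha k).comap_le ((pastFiltration a ha).le k) hm
      (indep_comap_agent_pastFiltration ha hindep k)).trans ?_
    have : ∫ ω, e i ω ∂μ = (m : ℝ)⁻¹ := by
      simp only [e]
      rw [integral_indicator_one (hset i), measureReal_def, hunif]
      simp
    rw [this]
  rw [heq]
  have hterm : ∀ i, μ[h i * e i | pastFiltration a ha k] =ᵐ[μ] fun ω => h i ω * (m : ℝ)⁻¹ := by
    intro i
    filter_upwards [condExp_stronglyMeasurable_mul_of_bound ((pastFiltration a ha).le k) (hh i)
      (heint i) C (hbd i), he i] with ω h1 h2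
    rw [h1, Pi.mul_apply, h2]
  filter_upwards [condExp_finsetSum (s := Finset.univ) (fun i _ => hint i) (pastFiltration a ha k),
    ae_all_iff.2 hterm] with ω h1 h2
  rw [h1, Finset.sum_apply, Finset.mul_sum]
  exact Finset.sum_congr rfl fun i _ => by rw [h2 i, mul_comm]

variable (G : ℕ → SimpleGraph (Fin m)) (c : ℕ → ℝ)

theorem measurable_gossipState (v : Fin m → ℝ) (k : ℕ) :
    Measurable[pastFiltration a ha k] (gossipState G c a v k) := by
  induction k with
  | zero => exact measurable_const
  | succ k ih =>
    have hB : ∀ i, Measurable fun x : Fin m → ℝ => broadcastMatrix (G k) (c k) i *ᵥ x := fun i =>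
      (continuous_const.matrix_mulVec continuous_id).measurable
    have hprod : Measurable fun p : Fin m × (Fin m → ℝ) =>
        broadcastMatrix (G k) (c k) p.1 *ᵥ p.2 := measurable_from_prod_countable_right hB
    have ih' : Measurable[pastFiltration a ha (k + 1)] (gossipState G c a v k) :=
      ih.mono ((pastFiltration a ha).mono k.le_succ) le_rfl
    have hak := measurable_agent_pastFiltration ha k.lt_succ_self
    have hpair : Measurable[pastFiltration a ha (k + 1)]
        fun ω => (a k ω, gossipState G c a v k ω) := hak.prodMk ih'
    have hsucc : gossipState G c a v (k + 1) =
        (fun p : Fin m × (Fin m → ℝ) => broadcastMatrix (G k) (c k) p.1 *ᵥ p.2) ∘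
          fun ω => (a k ω, gossipState G c a v k ω) := by
      funext ω
      rw [gossipState]
      rfl
    rw [hsucc]
    exact hprod.comp hpair

theorem exists_bound_of_continuous {f : (Fin m → ℝ) → ℝ} (hf : Continuous f) (B : ℝ) :
    ∃ C, ∀ x : Fin m → ℝ, (∀ j, |x j| ≤ B) → |f x| ≤ C := by
  obtain ⟨C, hC⟩ := (isCompact_univ_pi fun _ : Fin m =>
    isCompact_Icc (a := -B) (b := B)).exists_bound_of_continuousOn hf.continuousOn
  exact ⟨C, fun x hx => hC x fun j _ => abs_le.1 (hx j)⟩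

theorem stronglyMeasurable_comp_gossipState (v : Fin m → ℝ) {f : (Fin m → ℝ) → ℝ}
    (hf : Continuous f) (k : ℕ) :
    StronglyMeasurable[pastFiltration a ha k] fun ω => f (gossipState G c a v k ω) :=
  (hf.measurable.comp (measurable_gossipState ha G c v k)).stronglyMeasurable

include ha in
theorem integrable_comp_gossipState (hc : ∀ k, c k ∈ Set.Icc (0 : ℝ) 1) (v : Fin m → ℝ)
    {f : (Fin m → ℝ) → ℝ} (hf : Continuous f) (k : ℕ) :
    Integrable (fun ω => f (gossipState G c a v k ω)) μ := by
  obtain ⟨C, hC⟩ := exists_bound_of_continuous hf ‖v‖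
  exact Integrable.of_bound ((stronglyMeasurable_comp_gossipState ha G c v hf k).mono
    ((pastFiltration a ha).le k)).aestronglyMeasurable C
    (Eventually.of_forall fun ω => hC _ (abs_gossipState_le G c a hc v k ω))

theorem condExp_comp_gossipState_succ (hindep : iIndepFun a μ)
    (hunif : ∀ k i, μ {ω | a k ω = i} = (m : ℝ≥0∞)⁻¹) (hc : ∀ k, c k ∈ Set.Icc (0 : ℝ) 1)
    (v : Fin m → ℝ) {f : (Fin m → ℝ) → ℝ} (hf : Continuous f) (k : ℕ) :
    μ[fun ω => f (gossipState G c a v (k + 1) ω) | pastFiltration a ha k] =ᵐ[μ]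
      fun ω => (m : ℝ)⁻¹ * ∑ i, f (broadcastMatrix (G k) (c k) i *ᵥ gossipState G c a v k ω) := by
  obtain ⟨C, hC⟩ := exists_bound_of_continuous hf ‖v‖
  refine condExp_agent_comp ha hindep hunif k
    (h := fun i ω => f (broadcastMatrix (G k) (c k) i *ᵥ gossipState G c a v k ω))
    (fun i => ?_) (C := C) (fun i ω => ?_)
  · exact stronglyMeasurable_comp_gossipState ha G c v (hf.comp
      (Continuous.matrix_mulVec continuous_const continuous_id)) k
  · exact hC _ (abs_broadcastMatrix_mulVec_le (G k) (hc k) i (abs_gossipState_le G c a hc v k ω))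

include ha in
/-- For convex `g`, the sum of `g` over all agents is a bounded supermartingale, so it converges. -/
theorem ae_exists_tendsto_sum_convexOn_gossipState (hm : 0 < m) (hindep : iIndepFun a μ)
    (hunif : ∀ k i, μ {ω | a k ω = i} = (m : ℝ≥0∞)⁻¹) (hc : ∀ k, c k ∈ Set.Icc (0 : ℝ) 1)
    (v : Fin m → ℝ) {g : ℝ → ℝ} (hg : ConvexOn ℝ Set.univ g) (hgc : Continuous g) :
    ∀ᵐ ω ∂μ, ∃ l, Tendsto (fun k => ∑ j, g (gossipState G c a v k ω j)) atTop (𝓝 l) := by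
  have hfc : Continuous fun x : Fin m → ℝ => ∑ j, g (x j) := by fun_prop
  have hsuper : Supermartingale (fun k ω => ∑ j, g (gossipState G c a v k ω j))
      (pastFiltration a ha) μ := by
    refine supermartingale_nat (fun k => stronglyMeasurable_comp_gossipState ha G c v hfc k)
      (fun k => integrable_comp_gossipState ha G c hc v hfc k) fun k => ?_
    filter_upwards [condExp_comp_gossipState_succ ha G c hindep hunif hc v hfc k] with ω hω
    rw [hω, inv_mul_le_iff₀ (by exact_mod_cast hm)]
    exact sum_sum_convexOn_broadcastMatrix_mulVec_le (G k) (hc k) hg _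
  obtain ⟨C, hC⟩ := exists_bound_of_continuous hfc ‖v‖
  have hbdd : ∀ k, eLpNorm ((-fun k ω => ∑ j, g (gossipState G c a v k ω j)) k) 1 μ
      ≤ (C.toNNReal : ℝ≥0∞) := by
    intro k
    refine (eLpNorm_le_of_ae_bound (C := C) (Eventually.of_forall fun ω => ?_)).trans ?_
    · simp only [Pi.neg_apply, norm_neg]
      exact hC _ (abs_gossipState_le G c a hc v k ω)
    · simp [ENNReal.ofReal]
  filter_upwards [hsuper.neg.exists_ae_tendsto_of_bdd hbdd] with ω ⟨l, hl⟩
  exact ⟨-l, by simpa using hl.neg⟩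

include ha in
open scoped Classical in
theorem integral_sum_sq_gossipState_succ (hm : 0 < m) (hindep : iIndepFun a μ)
    (hunif : ∀ k i, μ {ω | a k ω = i} = (m : ℝ≥0∞)⁻¹) (hc : ∀ k, c k ∈ Set.Icc (0 : ℝ) 1)
    (v : Fin m → ℝ) (k : ℕ) :
    ∫ ω, ∑ j, gossipState G c a v (k + 1) ω j ^ 2 ∂μ = ∫ ω, ∑ j, gossipState G c a v k ω j ^ 2 ∂μ
      - (m : ℝ)⁻¹ * (c k * (1 - c k)) * ∫ ω, ∑ i, ∑ j, (if (G k).Adj i j then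
        (gossipState G c a v k ω i - gossipState G c a v k ω j) ^ 2 else 0) ∂μ := by
  have hfc : Continuous fun x : Fin m → ℝ => ∑ j, x j ^ 2 := by fun_prop
  have hDc : Continuous fun x : Fin m → ℝ =>
      ∑ i, ∑ j, (if (G k).Adj i j then (x i - x j) ^ 2 else 0) := by
    refine continuous_finsetSum _ fun i _ => continuous_finsetSum _ fun j _ => ?_
    split_ifs <;> fun_prop
  have hm' : (m : ℝ) ≠ 0 := by positivity
  rw [← integral_condExp ((pastFiltration a ha).le k),
    integral_congr_ae (condExp_comp_gossipState_succ ha G c hindep hunif hc v hfc k),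
    ← integral_const_mul, ← integral_sub (integrable_comp_gossipState ha G c hc v hfc k)
      ((integrable_comp_gossipState ha G c hc v hDc k).const_mul _)]
  refine integral_congr_ae (Eventually.of_forall fun ω => ?_)
  simp only [sum_sum_sq_broadcastMatrix_mulVec]
  field_simp

include ha in
open scoped Classical in
/-- The energy dissipated along the edges is almost surely finite. -/
theorem ae_summable_energy_gossipState (hm : 0 < m) (hindep : iIndepFun a μ)
    (hunif : ∀ k i, μ {ω | a k ω = i} = (m : ℝ≥0∞)⁻¹) {γ : ℝ} (hγ : γ < 1)
    (hc : ∀ k, c k ∈ Set.Ioc (0 : ℝ) γ) (v : Fin m → ℝ) :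
    ∀ᵐ ω ∂μ, Summable fun k => c k * ∑ i, ∑ j, (if (G k).Adj i j then
        (gossipState G c a v k ω i - gossipState G c a v k ω j) ^ 2 else 0) := by
  have hc' : ∀ k, c k ∈ Set.Icc (0 : ℝ) 1 := fun k => ⟨(hc k).1.le, (hc k).2.trans hγ.le⟩
  have hm' : (0 : ℝ) < m := by exact_mod_cast hm
  have hγ' : 0 < 1 - γ := by linarith
  let D : ℕ → Ω → ℝ := fun k ω => ∑ i, ∑ j, (if (G k).Adj i j then
        (gossipState G c a v k ω i - gossipState G c a v k ω j) ^ 2 else 0)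
  let V : ℕ → ℝ := fun k => ∫ ω, ∑ j, gossipState G c a v k ω j ^ 2 ∂μ
  have hD0 : ∀ k ω, 0 ≤ D k ω := fun k ω =>
    Finset.sum_nonneg fun i _ => Finset.sum_nonneg fun j _ => by split_ifs <;> positivity
  have hV0 : ∀ k, 0 ≤ V k := fun k =>
    integral_nonneg fun ω => Finset.sum_nonneg fun j _ => sq_nonneg _
  have hint : ∀ k, Integrable (D k) μ := fun k => by
    refine integrable_comp_gossipState ha G c hc' v (f := fun x : Fin m → ℝ =>
      ∑ i, ∑ j, (if (G k).Adj i j then (x i - x j) ^ 2 else 0)) ?_ k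
    refine continuous_finsetSum _ fun i _ => continuous_finsetSum _ fun j _ => ?_
    split_ifs <;> fun_prop
  refine ae_summable_of_summable_integral (f := fun k ω => c k * D k ω)
    (fun k => (hint k).const_mul _) (fun k ω => mul_nonneg (hc' k).1 (hD0 k ω)) ?_
  -- The right side telescopes, so the total expected energy is at most `m / (1 - γ) * V 0`. The
  -- bound `c k ≤ γ < 1` keeps the dissipation factor away from `0`.
  have hstep : ∀ k, (m : ℝ)⁻¹ * (1 - γ) * ∫ ω, c k * D k ω ∂μ ≤ V k - V (k + 1) := by
    intro k
    have h := integral_sum_sq_gossipState_succ ha G c hm hindep hunif hc' v k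
    have hI : 0 ≤ ∫ ω, D k ω ∂μ := integral_nonneg (hD0 k)
    have h1 : (m : ℝ)⁻¹ * (1 - γ) * ∫ ω, c k * D k ω ∂μ
        ≤ (m : ℝ)⁻¹ * (c k * (1 - c k)) * ∫ ω, D k ω ∂μ := by
      rw [integral_const_mul, ← mul_assoc]
      refine mul_le_mul_of_nonneg_right ?_ hI
      rw [mul_assoc]
      refine mul_le_mul_of_nonneg_left ?_ (by positivity)
      rw [mul_comm]
      exact mul_le_mul_of_nonneg_left (by linarith [(hc k).2]) (hc' k).1
    change V (k + 1) = V k - (m : ℝ)⁻¹ * (c k * (1 - c k)) * ∫ ω, D k ω ∂μ at h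
    linarith
  have hpos : (0 : ℝ) < (m : ℝ)⁻¹ * (1 - γ) := by positivity
  refine summable_of_sum_range_le (c := ((m : ℝ)⁻¹ * (1 - γ))⁻¹ * V 0)
    (fun k => integral_nonneg fun ω => mul_nonneg (hc' k).1 (hD0 k ω)) fun n => ?_
  rw [le_inv_mul_iff₀ hpos, Finset.mul_sum]
  refine (Finset.sum_le_sum fun k _ => hstep k).trans ?_
  rw [Finset.sum_range_sub']
  linarith [hV0 n]

include ha in
theorem ae_exists_tendsto_gossipState (hm : 0 < m) (hindep : iIndepFun a μ)
    (hunif : ∀ k i, μ {ω | a k ω = i} = (m : ℝ≥0∞)⁻¹) {γ : ℝ} (hγ : γ < 1)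
    (hc : ∀ k, c k ∈ Set.Ioc (0 : ℝ) γ) (v : Fin m → ℝ) :
    ∀ᵐ ω ∂μ, ∀ i, ∃ l, Tendsto (fun k => gossipState G c a v k ω i) atTop (𝓝 l) := by
  have hc' : ∀ k, c k ∈ Set.Icc (0 : ℝ) 1 := fun k => ⟨(hc k).1.le, (hc k).2.trans hγ.le⟩
  have hconv : ∀ q : ℚ, ∀ᵐ ω ∂μ, ∃ l,
      Tendsto (fun k => ∑ j, |gossipState G c a v k ω j - q|) atTop (𝓝 l) := by
    intro q
    refine ae_exists_tendsto_sum_convexOn_gossipState ha G c hm hindep hunif hc' v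
      (g := fun x => |x - q|) ?_ (by fun_prop)
    have := convexOn_univ_norm (E := ℝ) |>.translate_left (-(q : ℝ))
    simpa [Function.comp_def, sub_eq_add_neg] using this
  filter_upwards [ae_all_iff.2 hconv, ae_summable_energy_gossipState ha G c hm hindep hunif hγ hc v]
    with ω h1 h2
  refine exists_tendsto_of_tendsto_sum_abs (abs_gossipState_le G c a hc' v · ω) (fun j => ?_) h1
  have hsq : Tendsto
      (fun k => (gossipState G c a v (k + 1) ω j - gossipState G c a v k ω j) ^ 2) atTop (𝓝 0) :=
    squeeze_zero (fun k => sq_nonneg _) (fun k => sq_sub_gossipState_succ_le G c a hc' v k ω j)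
      h2.tendsto_atTop_zero
  have := hsq.sqrt
  simp only [Real.sqrt_sq_eq_abs, Real.sqrt_zero] at this
  exact (tendsto_zero_iff_abs_tendsto_zero _).2 this

-- The energy dominates the term of `{i, j}` alone; since both agents converge and the weights have
-- infinite sum, the limiting difference is `0`.
include ha in
open scoped Classical in
theorem ae_tendsto_gossipState_sub (hm : 0 < m) (hindep : iIndepFun a μ)
    (hunif : ∀ k i, μ {ω | a k ω = i} = (m : ℝ≥0∞)⁻¹) {γ : ℝ} (hγ : γ < 1)
    (hc : ∀ k, c k ∈ Set.Ioc (0 : ℝ) γ) (v : Fin m → ℝ) {i j : Fin m}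
    (hij : ¬ Summable fun k => if (G k).Adj i j then c k else 0) :
    ∀ᵐ ω ∂μ, Tendsto (fun k => gossipState G c a v k ω i - gossipState G c a v k ω j)
      atTop (𝓝 0) := by
  filter_upwards [ae_exists_tendsto_gossipState ha G c hm hindep hunif hγ hc v,
    ae_summable_energy_gossipState ha G c hm hindep hunif hγ hc v] with ω h1 h2
  obtain ⟨l, hl⟩ := h1 i
  obtain ⟨l', hl'⟩ := h1 j
  have hw : ∀ k, 0 ≤ if (G k).Adj i j then c k else 0 := fun k => by
    split_ifs
    · exact (hc k).1.le
    · exact le_rfl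
  refine tendsto_zero_of_summable_mul_sq (hl.sub hl') hw hij
    (Summable.of_nonneg_of_le (fun k => mul_nonneg (hw k) (sq_nonneg _)) (fun k => ?_) h2)
  have hnn : ∀ i j, 0 ≤ if (G k).Adj i j then
      (gossipState G c a v k ω i - gossipState G c a v k ω j) ^ 2 else 0 := fun i j => by
    split_ifs <;> positivity
  have hle := (Finset.single_le_sum (fun j _ => hnn i j) (Finset.mem_univ j)).trans
    (Finset.single_le_sum (f := fun i => ∑ j, if (G k).Adj i j then
      (gossipState G c a v k ω i - gossipState G c a v k ω j) ^ 2 else 0)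
      (fun i _ => Finset.sum_nonneg fun j _ => hnn i j) (Finset.mem_univ i))
  refine le_trans (le_of_eq ?_) (mul_le_mul_of_nonneg_left hle (hc k).1.le)
  split_ifs <;> simp

include ha in
open scoped Classical in
/-- If the weights of the edge `{i, j}` are not summable, the flow across it is almost surely
infinite. -/
theorem ae_tendsto_sum_flow_atTop (hm : 0 < m) (hindep : iIndepFun a μ)
    (hunif : ∀ k i, μ {ω | a k ω = i} = (m : ℝ≥0∞)⁻¹) (hc : ∀ k, c k ∈ Set.Icc (0 : ℝ) 1)
    {i j : Fin m} (hne : i ≠ j) (hij : ¬ Summable fun k => if (G k).Adj i j then c k else 0) :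
    ∀ᵐ ω ∂μ, Tendsto (fun n => ∑ k ∈ Finset.range n,
      (broadcastGossip G c a k ω i j + broadcastGossip G c a k ω j i)) atTop atTop := by
  let w : ℕ → Fin m → ℝ := fun k l =>
    broadcastMatrix (G k) (c k) l i j + broadcastMatrix (G k) (c k) l j i
  have hw : ∀ k l, w k l = (if (G k).Adj i j ∧ l = j then c k else 0)
      + (if (G k).Adj i j ∧ l = i then c k else 0) := fun k l => by
    simp only [w]
    rw [broadcastMatrix_apply_of_ne _ _ _ hne, broadcastMatrix_apply_of_ne _ _ _ hne.symm,
      (G k).adj_comm j i]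
  have hw0 : ∀ k l, 0 ≤ w k l := fun k l => by
    have := (hc k).1
    rw [hw]
    split_ifs <;> linarith
  have hw2 : ∀ k l, |w k l| ≤ 2 := fun k l => by
    have := (hc k).1
    have := (hc k).2
    rw [abs_of_nonneg (hw0 k l), hw]
    split_ifs <;> linarith
  let f : ℕ → Ω → ℝ := fun n ω => ∑ k ∈ Finset.range n, w k (a k ω)
  have hfs : ∀ n ω, f (n + 1) ω - f n ω = w n (a n ω) := fun n ω => by
    simp [f, Finset.sum_range_succ]
  have hadp : StronglyAdapted (pastFiltration a ha) f := fun n => by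
    refine Measurable.stronglyMeasurable (Finset.measurable_fun_sum _ fun k hk => ?_)
    exact (measurable_of_countable (w k)).comp
      (measurable_agent_pastFiltration ha (Finset.mem_range.1 hk))
  have hint : ∀ n, Integrable (f n) μ := fun n =>
    integrable_finsetSum _ fun k _ => Integrable.of_bound
      ((measurable_of_countable (w k)).comp (ha k)).aestronglyMeasurable 2
      (Eventually.of_forall fun ω => hw2 k _)
  -- The factor `2` counts the two broadcasters, `i` and `j`, that create flow across the edge. As
  -- increments of `f` are nonnegative and bounded, `f` diverges exactly when its predictable part
  -- does.
  have hcond : ∀ k, μ[f (k + 1) - f k | pastFiltration a ha k] =ᵐ[μ]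
      fun _ => (m : ℝ)⁻¹ * (2 * if (G k).Adj i j then c k else 0) := fun k => by
    have h1 : f (k + 1) - f k = fun ω => w k (a k ω) := funext (hfs k)
    rw [h1]
    refine (condExp_agent_comp ha hindep hunif k (h := fun l _ => w k l)
      (fun l => stronglyMeasurable_const) (fun l _ => hw2 k l)).trans
      (Eventually.of_forall fun ω => ?_)
    simp only [hw, Finset.sum_add_distrib]
    congr 1
    by_cases hadj : (G k).Adj i j
    · simp [hadj, two_mul]
    · simp [hadj]
  have hnn : ∀ k, 0 ≤ if (G k).Adj i j then c k else 0 := fun k => by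
    split_ifs
    · exact (hc k).1
    · exact le_rfl
  have hdiv := (not_summable_iff_tendsto_nat_atTop_of_nonneg hnn).1 hij
  filter_upwards [tendsto_sum_indicator_atTop_iff (R := 2)
    (Eventually.of_forall fun ω n => by linarith [hfs n ω, hw0 n (a n ω)]) hadp hint
    (Eventually.of_forall fun ω n => by rw [hfs]; exact hw2 _ _), ae_all_iff.2 hcond] with ω h1 h2
  refine h1.2 ?_
  have hm' : (0 : ℝ) < (m : ℝ)⁻¹ * 2 := by positivity
  refine (hdiv.const_mul_atTop hm').congr fun n => ?_
  simp only [predictablePart, Finset.sum_apply, h2, Finset.mul_sum, mul_assoc]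

end Probability

/-! ### From basis states to all trajectories, and the flow graph -/

section Main

variable [MeasurableSpace Ω] {μ : Measure Ω} [IsProbabilityMeasure μ]
  (G : ℕ → SimpleGraph (Fin m)) (c : ℕ → ℝ) {a : ℕ → Ω → Fin m}

theorem ae_stable_broadcastGossip (ha : ∀ k, Measurable (a k)) (hm : 0 < m)
    (hindep : iIndepFun a μ) (hunif : ∀ k i, μ {ω | a k ω = i} = (m : ℝ≥0∞)⁻¹) {γ : ℝ} (hγ : γ < 1)
    (hc : ∀ k, c k ∈ Set.Ioc (0 : ℝ) γ) :
    ∀ᵐ ω ∂μ, Stable (fun k => broadcastGossip G c a k ω) := by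
  have h : ∀ (t₀ : ℕ) (l : Fin m), ∀ᵐ ω ∂μ, ∀ i, ∃ y, Tendsto
      (fun n => gossipState (fun k => G (t₀ + k)) (fun k => c (t₀ + k)) (fun k => a (t₀ + k))
        (Pi.single l 1) n ω i) atTop (𝓝 y) := fun t₀ l =>
    ae_exists_tendsto_gossipState (fun k => ha _) _ _ hm (hindep.precomp (add_right_injective t₀))
      (fun k => hunif _) hγ (fun k => hc _) _
  filter_upwards [ae_all_iff.2 fun t₀ => ae_all_iff.2 (h t₀)] with ω hω i t₀ x hx
  choose y hy using fun l => hω t₀ l i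
  refine ⟨∑ l, x t₀ l * y l, ?_⟩
  rw [← tendsto_add_atTop_iff_nat t₀]
  refine (tendsto_finsetSum Finset.univ fun l _ => (hy l).const_mul (x t₀ l)).congr fun n => ?_
  rw [add_comm n, hx.eq_sum_gossipState]
  simp [Finset.sum_apply]

open scoped Classical in
theorem ae_mutuallyWeaklyErgodic_of_not_summable (ha : ∀ k, Measurable (a k)) (hm : 0 < m)
    (hindep : iIndepFun a μ) (hunif : ∀ k i, μ {ω | a k ω = i} = (m : ℝ≥0∞)⁻¹) {γ : ℝ} (hγ : γ < 1)
    (hc : ∀ k, c k ∈ Set.Ioc (0 : ℝ) γ) {i j : Fin m}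
    (hij : ¬ Summable fun k => if (G k).Adj i j then c k else 0) :
    ∀ᵐ ω ∂μ, MutuallyWeaklyErgodic (fun k => broadcastGossip G c a k ω) i j := by
  have hshift : ∀ t₀, ¬ Summable fun k => if (G (t₀ + k)).Adj i j then c (t₀ + k) else 0 := by
    intro t₀ hs
    refine hij ((summable_nat_add_iff t₀).1 ?_)
    simpa only [add_comm t₀] using hs
  have h : ∀ (t₀ : ℕ) (l : Fin m), ∀ᵐ ω ∂μ, Tendsto (fun n =>
      gossipState (fun k => G (t₀ + k)) (fun k => c (t₀ + k)) (fun k => a (t₀ + k))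
        (Pi.single l 1) n ω i -
      gossipState (fun k => G (t₀ + k)) (fun k => c (t₀ + k)) (fun k => a (t₀ + k))
        (Pi.single l 1) n ω j) atTop (𝓝 0) := fun t₀ l =>
    ae_tendsto_gossipState_sub (fun k => ha _) _ _ hm (hindep.precomp (add_right_injective t₀))
      (fun k => hunif _) hγ (fun k => hc _) _ (hshift t₀)
  filter_upwards [ae_all_iff.2 fun t₀ => ae_all_iff.2 (h t₀)] with ω hω t₀ x hx
  rw [← tendsto_add_atTop_iff_nat t₀]
  have hlim := tendsto_finsetSum Finset.univ fun l _ => (hω t₀ l).const_mul (x t₀ l)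
  simp only [mul_zero, Finset.sum_const_zero] at hlim
  refine hlim.congr fun n => ?_
  rw [add_comm n, hx.eq_sum_gossipState]
  simp [Finset.sum_apply, mul_sub]

-- For the forward direction one realization is enough: the broadcaster is never both `i` and `j`,
-- so the flow at time `k` is at most the edge weight.
open scoped Classical in
theorem infiniteFlowGraph_broadcastGossip_adj_iff (ha : ∀ k, Measurable (a k)) (hm : 0 < m)
    (hindep : iIndepFun a μ) (hunif : ∀ k i, μ {ω | a k ω = i} = (m : ℝ≥0∞)⁻¹)
    (hc : ∀ k, c k ∈ Set.Icc (0 : ℝ) 1) {i j : Fin m} :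
    (infiniteFlowGraph μ (broadcastGossip G c a)).Adj i j ↔
      i ≠ j ∧ ¬ Summable fun k => if (G k).Adj i j then c k else 0 := by
  refine and_congr_right fun hne => ⟨fun h hs => ?_, fun h =>
    ae_tendsto_sum_flow_atTop ha G c hm hindep hunif hc hne h⟩
  obtain ⟨ω, hω⟩ := h.exists
  have hnn : ∀ k, 0 ≤ if (G k).Adj i j then c k else 0 := fun k => by
    split_ifs
    · exact (hc k).1
    · exact le_rfl
  refine (not_summable_iff_tendsto_nat_atTop_of_nonneg hnn).2
    (tendsto_atTop_mono (fun n => Finset.sum_le_sum fun k _ => ?_) hω) hs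
  rw [broadcastGossip, broadcastMatrix_apply_of_ne _ _ _ hne,
    broadcastMatrix_apply_of_ne _ _ _ hne.symm, (G k).adj_comm j i]
  by_cases hadj : (G k).Adj i j
  · by_cases hj : a k ω = j
    · simp [hadj, hj, hne.symm]
    · have := (hc k).1
      simp only [hadj, hj, true_and, if_false, if_true, zero_add]
      split_ifs <;> linarith
  · simp [hadj]

/-- The cut is the component `S` of `i`. No pair leaving `S` is adjacent in the flow graph, so each
has summable weight, and there are finitely many pairs. -/
theorem not_mutuallyWeaklyErgodic_of_not_reachable (ha : ∀ k, Measurable (a k)) (hm : 0 < m)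
    (hindep : iIndepFun a μ) (hunif : ∀ k i, μ {ω | a k ω = i} = (m : ℝ≥0∞)⁻¹)
    (hc : ∀ k, c k ∈ Set.Icc (0 : ℝ) 1) {i j : Fin m}
    (hij : ¬ (infiniteFlowGraph μ (broadcastGossip G c a)).Reachable i j) (ω : Ω) :
    ¬ MutuallyWeaklyErgodic (fun k => broadcastGossip G c a k ω) i j := by
  classical
  let S : Set (Fin m) := {l | (infiniteFlowGraph μ (broadcastGossip G c a)).Reachable i l}
  have hpair : ∀ p q, Summable fun k => if p ∈ S ∧ q ∉ S ∧ (G k).Adj p q then c k else 0 := by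
    intro p q
    by_cases hpq : p ∈ S ∧ q ∉ S
    · have hnadj : ¬ (infiniteFlowGraph μ (broadcastGossip G c a)).Adj p q := fun hadj =>
        hpq.2 (hpq.1.trans hadj.reachable)
      rw [infiniteFlowGraph_broadcastGossip_adj_iff G c ha hm hindep hunif hc, not_and,
        not_not] at hnadj
      simpa [hpq.1, hpq.2] using hnadj (by rintro rfl; exact hpq.2 hpq.1)
    · have : ∀ k, ¬ (p ∈ S ∧ q ∉ S ∧ (G k).Adj p q) := fun k h => hpq ⟨h.1, h.2.1⟩
      simp [this, summable_zero]
  have hnn : ∀ k p q, 0 ≤ if p ∈ S ∧ q ∉ S ∧ (G k).Adj p q then c k else 0 := fun k p q => by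
    split_ifs
    · exact (hc k).1
    · exact le_rfl
  refine not_mutuallyWeaklyErgodic_of_summable G c a hc (S := S) ?_
    (SimpleGraph.Reachable.refl i) hij ω
  refine Summable.of_nonneg_of_le (fun k => ?_) (fun k => ?_)
    (summable_sum (s := Finset.univ) fun p _ => summable_sum (s := Finset.univ) fun q _ => hpair p q)
  · split_ifs
    · exact (hc k).1
    · exact le_rfl
  · split_ifs with h
    · obtain ⟨p, hp, q, hq, hadj⟩ := h
      have h1 := (Finset.single_le_sum (fun q _ => hnn k p q) (Finset.mem_univ q)).trans
        (Finset.single_le_sum (f := fun p => ∑ q, if p ∈ S ∧ q ∉ S ∧ (G k).Adj p q then c k else 0)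
          (fun p _ => Finset.sum_nonneg fun q _ => hnn k p q) (Finset.mem_univ p))
      rwa [if_pos ⟨hp, hq, hadj⟩] at h1
    · exact Finset.sum_nonneg fun p _ => Finset.sum_nonneg fun q _ => hnn k p q

theorem ergodicitySetoid_broadcastGossip_iff_reachable (ha : ∀ k, Measurable (a k)) (hm : 0 < m)
    (hindep : iIndepFun a μ) (hunif : ∀ k i, μ {ω | a k ω = i} = (m : ℝ≥0∞)⁻¹) {γ : ℝ} (hγ : γ < 1)
    (hc : ∀ k, c k ∈ Set.Ioc (0 : ℝ) γ) (i j : Fin m) :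
    ergodicitySetoid μ (broadcastGossip G c a) i j ↔
      (infiniteFlowGraph μ (broadcastGossip G c a)).Reachable i j := by
  classical
  have hc' : ∀ k, c k ∈ Set.Icc (0 : ℝ) 1 := fun k => ⟨(hc k).1.le, (hc k).2.trans hγ.le⟩
  constructor
  · intro h
    by_contra hn
    obtain ⟨ω, hω⟩ := Eventually.exists
      (show ∀ᵐ ω ∂μ, MutuallyWeaklyErgodic (fun k => broadcastGossip G c a k ω) i j from h)
    exact not_mutuallyWeaklyErgodic_of_not_reachable G c ha hm hindep hunif hc' hn ω hω
  · rintro ⟨p⟩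
    induction p with
    | nil => exact (ergodicitySetoid μ (broadcastGossip G c a)).refl _
    | cons hadj _ ih =>
      refine (ergodicitySetoid μ (broadcastGossip G c a)).trans ?_ ih
      exact ae_mutuallyWeaklyErgodic_of_not_summable G c ha hm hindep hunif hγ hc
        ((infiniteFlowGraph_broadcastGossip_adj_iff G c ha hm hindep hunif hc').1 hadj).2

end Main

end RandomChain

theorem mainTheorem9 {Ω : Type*} [MeasurableSpace Ω] (μ : Measure Ω) [IsProbabilityMeasure μ]
    (m : ℕ) (hm : 0 < m)
    (G : ℕ → SimpleGraph (Fin m))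
    (γ : ℝ) (hγ : γ ∈ Set.Ioo (0 : ℝ) 1)
    (c : ℕ → ℝ) (hc : ∀ k, c k ∈ Set.Ioc (0 : ℝ) γ)
    (a : ℕ → Ω → Fin m) (ha_meas : ∀ k, Measurable (a k)) (ha_indep : iIndepFun a μ)
    (ha_unif : ∀ k i, μ {ω | a k ω = i} = (m : ℝ≥0∞)⁻¹) :
    (∀ᵐ ω ∂μ, RandomChain.Stable (fun k => RandomChain.broadcastGossip G c a k ω)) ∧
    (∀ i j : Fin m,
      ((RandomChain.ergodicitySetoid μ (RandomChain.broadcastGossip G c a)) i j ↔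
        (RandomChain.infiniteFlowGraph μ (RandomChain.broadcastGossip G c a)).Reachable i j) ∧
      (¬ (RandomChain.infiniteFlowGraph μ (RandomChain.broadcastGossip G c a)).Reachable i j →
        ∀ᵐ ω ∂μ, ¬ RandomChain.MutuallyWeaklyErgodic
          (fun k => RandomChain.broadcastGossip G c a k ω) i j)) ∧
    ((∀ᵐ ω ∂μ, RandomChain.Ergodic (fun k => RandomChain.broadcastGossip G c a k ω)) ↔
      (RandomChain.infiniteFlowGraph μ (RandomChain.broadcastGossip G c a)).Connected) := by
  have hc' : ∀ k, c k ∈ Set.Icc (0 : ℝ) 1 := fun k => ⟨(hc k).1.le, (hc k).2.trans hγ.2.le⟩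
  have hiff := RandomChain.ergodicitySetoid_broadcastGossip_iff_reachable G c ha_meas hm ha_indep
    ha_unif hγ.2 hc
  refine ⟨RandomChain.ae_stable_broadcastGossip G c ha_meas hm ha_indep ha_unif hγ.2 hc,
    fun i j => ⟨hiff i j, fun hn => Eventually.of_forall fun ω =>
      RandomChain.not_mutuallyWeaklyErgodic_of_not_reachable G c ha_meas hm ha_indep ha_unif hc'
        hn ω⟩, fun h => ?_, fun h => ?_⟩
  · have : Nonempty (Fin m) := ⟨⟨0, hm⟩⟩
    refine ⟨fun i j => (hiff i j).1 ?_⟩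
    filter_upwards [h] with ω hω t₀ x hx using hω t₀ x hx i j
  · have hall : ∀ i j, ∀ᵐ ω ∂μ, RandomChain.MutuallyWeaklyErgodic
        (fun k => RandomChain.broadcastGossip G c a k ω) i j :=
      fun i j => (hiff i j).2 (h.preconnected i j)
    filter_upwards [ae_all_iff.2 fun i => ae_all_iff.2 (hall i)] with ω hω t₀ x hx i j
    exact hω i j t₀ x hx
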